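/- Let $(S,d)$ be a complete separable metric space with its Borel $\sigma$-algebra, and let $(\Omega,\mathcal F,P)$ be a complete nonatomic probability space, i.e. every $A\in\mathcal F$ with $P(A)>0$ contains some $B\in\mathcal F$ with $0<P(B)<P(A)$. Let $\mathcal P(S)$ be the space of Borel probability measures on $S$ with the topology of weak convergence, and let $L^0(\Omega,S)$ be the space of $S$-valued random variables on $\Omega$, modulo almost sure equality, with the topology of convergence in probability, i.e. the topology of the metric $\rho(X,Y)=\inf\{\varepsilon>0: P(d(X,Y)\ge\varepsilon)\le\varepsilon\}$. For $X\in L^0(\Omega,S)$ let $\mathrm{law}(X)\in\mathcal P(S)$ be its distribution, $\mathrm{law}(X)(A)=P(X^{-1}(A))$. Let $\alpha:[0,1]\to\mathcal P(S)$ be continuous. Then there is a continuous $\hat\alpha:[0,1]\to L^0(\Omega,S)$ with $\mathrm{law}(\hat\alpha(t))=\alpha(t)$ for all $t\in[0,1]$. Moreover, for all $X_\mu,X_\nu\in L^0(\Omega,S)$ with $\mathrm{law}(X_\mu)=\alpha(0)$ and $\mathrm{law}(X_\nu)=\alpha(1)$, such an $\hat\alpha$ can be chosen with $\hat\alpha(0)=X_\mu$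 and $\hat\alpha(1)=X_\nu$. -/

import Mathlib

open MeasureTheory ProbabilityTheory Filter
open scoped Topology ENNReal unitInterval

/-- A measure space is nonatomic if every measurable set of positive measure contains a
measurable subset of strictly smaller positive measure. (Mathlib's class for measures that
vanish on singletons is a different notion.) -/
def IsNonatomic {Ω : Type*} [MeasurableSpace Ω] (P : Measure Ω) : Prop :=
  ∀ A : Set Ω, MeasurableSet A → 0 < P A →
    ∃ B : Set Ω, B ⊆ A ∧ MeasurableSet B ∧ 0 < P B ∧ P B < P A

/-- The space `L⁰(Ω, S)` of `S`-valued random variables on `(Ω, P)`, modulo almost sure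
equality. -/
def RandomVar {Ω : Type*} [MeasurableSpace Ω] (P : Measure Ω) (S : Type*) [TopologicalSpace S] :
    Type _ :=
  Ω →ₘ[P] S

namespace RandomVar

variable {Ω : Type*} [MeasurableSpace Ω] {P : Measure Ω} {S : Type*}

/-- The underlying almost-everywhere class. -/
def toAEEqFun [TopologicalSpace S] (X : RandomVar P S) : Ω →ₘ[P] S := X

/-- The law (distribution) of a random variable: `law X A = P (X⁻¹ A)`. -/
noncomputable def law [IsProbabilityMeasure P] [TopologicalSpace S]
    [TopologicalSpace.PseudoMetrizableSpace S] [MeasurableSpace S] [BorelSpace S]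
    (X : RandomVar P S) : ProbabilityMeasure S :=
  ⟨P.map X.toAEEqFun, Measure.isProbabilityMeasure_map X.toAEEqFun.aemeasurable⟩

section KyFan

variable [MetricSpace S]

/-- The set of `ε > 0` with `P {d(X, Y) ≥ ε} ≤ ε`. -/
def kyFanSet (X Y : RandomVar P S) : Set ℝ :=
  {ε | 0 < ε ∧ P {ω | ε ≤ dist (X.toAEEqFun ω) (Y.toAEEqFun ω)} ≤ ENNReal.ofReal ε}

/-- The metric of convergence in probability,
`ρ(X, Y) = inf {ε > 0 : P {d(X, Y) ≥ ε} ≤ ε}`. -/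
noncomputable def kyFan (X Y : RandomVar P S) : ℝ := sInf (kyFanSet X Y)

theorem kyFanSet_nonempty [IsProbabilityMeasure P] (X Y : RandomVar P S) :
    (kyFanSet X Y).Nonempty :=
  ⟨1, one_pos, by simpa using prob_le_one⟩

theorem kyFanSet_bddBelow (X Y : RandomVar P S) : BddBelow (kyFanSet X Y) :=
  ⟨0, fun _ h => h.1.le⟩

theorem kyFan_nonneg (X Y : RandomVar P S) : 0 ≤ kyFan X Y :=
  Real.sInf_nonneg fun _ h => h.1.le

theorem kyFan_le_of_mem {X Y : RandomVar P S} {ε : ℝ} (h : ε ∈ kyFanSet X Y) : kyFan X Y ≤ ε :=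
  csInf_le (kyFanSet_bddBelow X Y) h

theorem mem_kyFanSet_of_lt [IsProbabilityMeasure P] {X Y : RandomVar P S} {ε : ℝ}
    (h : kyFan X Y < ε) : ε ∈ kyFanSet X Y := by
  obtain ⟨δ, hδ, hlt⟩ := exists_lt_of_csInf_lt (kyFanSet_nonempty X Y) h
  refine ⟨hδ.1.trans hlt, ?_⟩
  calc P {ω | ε ≤ dist (X.toAEEqFun ω) (Y.toAEEqFun ω)}
      ≤ P {ω | δ ≤ dist (X.toAEEqFun ω) (Y.toAEEqFun ω)} :=
        measure_mono fun ω hω => hlt.le.trans hω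
    _ ≤ ENNReal.ofReal δ := hδ.2
    _ ≤ ENNReal.ofReal ε := ENNReal.ofReal_le_ofReal hlt.le

theorem kyFan_self [IsProbabilityMeasure P] (X : RandomVar P S) : kyFan X X = 0 := by
  refine le_antisymm (le_of_forall_pos_le_add fun ε hε => ?_) (kyFan_nonneg X X)
  rw [zero_add]
  refine kyFan_le_of_mem ⟨hε, ?_⟩
  have : {ω : Ω | ε ≤ dist (X.toAEEqFun ω) (X.toAEEqFun ω)} = ∅ := by
    ext ω
    simpa using hε
  rw [this, measure_empty]
  exact zero_le

theorem kyFan_comm (X Y : RandomVar P S) : kyFan X Y = kyFan Y X := by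
  simp only [kyFan, kyFanSet, dist_comm]

theorem kyFan_triangle [IsProbabilityMeasure P] (X Y Z : RandomVar P S) :
    kyFan X Z ≤ kyFan X Y + kyFan Y Z := by
  refine le_of_forall_pos_le_add fun ε hε => ?_
  have h1 : kyFan X Y + ε / 2 ∈ kyFanSet X Y := mem_kyFanSet_of_lt (by linarith)
  have h2 : kyFan Y Z + ε / 2 ∈ kyFanSet Y Z := mem_kyFanSet_of_lt (by linarith)
  have h3 : (kyFan X Y + ε / 2) + (kyFan Y Z + ε / 2) ∈ kyFanSet X Z := by
    refine ⟨add_pos h1.1 h2.1, ?_⟩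
    rw [ENNReal.ofReal_add h1.1.le h2.1.le]
    refine le_trans (le_trans (measure_mono ?_) (measure_union_le _ _)) (add_le_add h1.2 h2.2)
    intro ω hω
    simp only [Set.mem_ofPred_eq, Set.mem_union] at hω ⊢
    by_contra! hcon
    have := dist_triangle (X.toAEEqFun ω) (Y.toAEEqFun ω) (Z.toAEEqFun ω)
    linarith [hcon.1, hcon.2]
  linarith [kyFan_le_of_mem h3]

theorem eq_of_kyFan_eq_zero [IsProbabilityMeasure P] {X Y : RandomVar P S}
    (h : kyFan X Y = 0) : X = Y := by
  have key : ∀ δ : ℝ, 0 < δ → P {ω | δ ≤ dist (X.toAEEqFun ω) (Y.toAEEqFun ω)} = 0 := by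
    intro δ hδ
    refine le_antisymm (ENNReal.le_of_forall_pos_le_add fun ε hε _ => ?_) zero_le
    have hm : min δ (ε : ℝ) ∈ kyFanSet X Y :=
      mem_kyFanSet_of_lt (by rw [h]; exact lt_min hδ (by exact_mod_cast hε))
    rw [zero_add]
    calc P {ω | δ ≤ dist (X.toAEEqFun ω) (Y.toAEEqFun ω)}
        ≤ P {ω | min δ (ε : ℝ) ≤ dist (X.toAEEqFun ω) (Y.toAEEqFun ω)} :=
          measure_mono fun ω (hω : δ ≤ _) => (min_le_left δ (ε : ℝ)).trans hω
      _ ≤ ENNReal.ofReal (min δ (ε : ℝ)) := hm.2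
      _ ≤ ENNReal.ofReal (ε : ℝ) := ENNReal.ofReal_le_ofReal (min_le_right _ _)
      _ = ε := ENNReal.ofReal_coe_nnreal
  have hall : ∀ᵐ ω ∂P, ∀ n : ℕ, ¬ 1 / ((n : ℝ) + 1) ≤ dist (X.toAEEqFun ω) (Y.toAEEqFun ω) := by
    rw [ae_all_iff]
    intro n
    rw [ae_iff]
    simpa only [not_not] using key _ Nat.one_div_pos_of_nat
  refine AEEqFun.ext (f := X.toAEEqFun) (g := Y.toAEEqFun) ?_
  filter_upwards [hall] with ω hω
  by_contra hne
  obtain ⟨n, hn⟩ := exists_nat_one_div_lt (dist_pos.2 hne)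
  exact hω n hn.le

/-- `L⁰(Ω, S)` with the topology of convergence in probability, metrized by `ρ`. -/
noncomputable instance [IsProbabilityMeasure P] : MetricSpace (RandomVar P S) where
  dist := kyFan
  dist_self := kyFan_self
  dist_comm := kyFan_comm
  dist_triangle := kyFan_triangle
  eq_of_dist_eq_zero := eq_of_kyFan_eq_zero

end KyFan

end RandomVar

/-! The problem is one of selection: the fibres `{X | law X = α t}` form a set-valued map on the
interval, and a continuous section with prescribed endpoints is wanted. The fibres are closed
because `law` is continuous, they lie in the complete space `L⁰`, and they are nonempty because a
nonatomic space carries every law (`IsNonatomic.exists_map_eq`). Over a one-dimensional base, two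
further properties suffice (`exists_continuous_section`): nearby fibres are uniformly close
(`fibersOpen_law`), and each fibre is connected by fine chains that do not stray far
(`chainConnected_law`). The section is a uniform limit of discontinuous sections whose oscillation
is halved at each stage, so no genuine paths inside a fibre are needed.

Both properties come from cutting `S` into countably many small pieces and working with the label of
the piece. On a nonatomic space a countably valued variable extends to a pair with any prescribed
compatible joint law (`IsNonatomic.exists_map_prodMk_eq`). Hence closeness of fibres reduces to
coupling two discrete label laws. Two variables of equal law are joined by switching from the label
of one to that of the other where a uniform variable, independent of both labels, is at most `u`; as
`u` runs from 0 to 1, consecutive variables are close. -/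

/-! ### Functions of small oscillation on an interval. -/

/-- `x` at time `a` and `y` at time `b` are joined by a function on `[a, b]` whose graph satisfies
`Q` and whose oscillation at every point is at most `η`. -/
def Linked {T L : Type*} [LinearOrder T] [TopologicalSpace T] [MetricSpace L] (η : ℝ)
    (Q : T → L → Prop) (a b : T) (x y : L) : Prop :=
  ∃ g : T → L, g a = x ∧ g b = y ∧ (∀ r ∈ Set.Icc a b, Q r (g r)) ∧
    ∀ r ∈ Set.Icc a b, ∀ᶠ s in 𝓝[Set.Icc a b] r, dist (g r) (g s) ≤ η

namespace Linked

variable {T L : Type*} [LinearOrder T] [TopologicalSpace T] [MetricSpace L]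
  {η : ℝ} {Q : T → L → Prop} {a b c : T} {x y z : L}

theorem refl (hη : 0 ≤ η) (hx : Q a x) : Linked η Q a a x x := by
  refine ⟨fun _ => x, rfl, rfl, fun r hr => ?_, fun r _ => by simp [hη]⟩
  rw [Set.Icc_self] at hr
  rwa [hr]

/-- All values can be chosen, without any regularity, in one ball of radius `η`, whose diameter
bounds the oscillation. -/
theorem of_forall_close (hab : a < b) (hx : Q a x) (hy : Q b y) (hxz : dist x z ≤ η)
    (hyz : dist y z ≤ η) (h : ∀ r ∈ Set.Icc a b, ∃ w, Q r w ∧ dist w z ≤ η) :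
    Linked (2 * η) Q a b x y := by
  have h' : ∀ r, ∃ w, (r ∈ Set.Icc a b → Q r w ∧ dist w z ≤ η) ∧ (r = a → w = x) ∧
      (r = b → w = y) := by
    intro r
    by_cases hra : r = a
    · exact ⟨x, fun _ => ⟨hra ▸ hx, hxz⟩, fun _ => rfl, fun e => absurd (hra.symm.trans e) hab.ne⟩
    by_cases hrb : r = b
    · exact ⟨y, fun _ => ⟨hrb ▸ hy, hyz⟩, fun e => absurd e hra, fun _ => rfl⟩
    by_cases hr : r ∈ Set.Icc a b
    · obtain ⟨w, hw⟩ := h r hr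
      exact ⟨w, fun _ => hw, fun e => absurd e hra, fun e => absurd e hrb⟩
    · exact ⟨x, fun e => absurd e hr, fun _ => rfl, fun e => absurd e hrb⟩
  choose g hg ga gb using h'
  refine ⟨g, ga a rfl, gb b rfl, fun r hr => (hg r hr).1, fun r hr => ?_⟩
  filter_upwards [self_mem_nhdsWithin] with s hs
  have := dist_triangle_right (g r) (g s) z
  linarith [(hg r hr).2, (hg s hs).2]

variable [OrderTopology T]

/-- Oscillation at `r` is measured from the value at `r`. At the junction each side is compared with
the common value there, so gluing does not enlarge `η`. -/
theorem trans (hab : a ≤ b) (hbc : b ≤ c) (h₁ : Linked η Q a b x y) (h₂ : Linked η Q b c y z) :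
    Linked η Q a c x z := by
  obtain ⟨g, ga, gb, gQ, gη⟩ := h₁
  obtain ⟨k, kb, kc, kQ, kη⟩ := h₂
  have left : ∀ r ≤ b, (if r ≤ b then g r else k r) = g r := fun r hr => if_pos hr
  have right : ∀ r, b ≤ r → (if r ≤ b then g r else k r) = k r := by
    intro r hr
    split_ifs with h
    · rw [le_antisymm h hr, gb, kb]
    · rfl
  refine ⟨fun r => if r ≤ b then g r else k r, ?_, ?_, ?_, ?_⟩
  · exact (left a hab).trans ga
  · exact (right c hbc).trans kc
  · intro r hr
    rcases le_total r b with h | h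
    · simpa only [left r h] using gQ r ⟨hr.1, h⟩
    · simpa only [right r h] using kQ r ⟨h, hr.2⟩
  · intro r hr
    rw [← Set.Icc_union_Icc_eq_Icc hab hbc, nhdsWithin_union, eventually_sup]
    constructor
    · rcases le_or_gt r b with h | h
      · filter_upwards [gη r ⟨hr.1, h⟩, self_mem_nhdsWithin] with s hs hs'
        simpa only [left r h, left s hs'.2] using hs
      · have : 𝓝[Set.Icc a b] r = ⊥ := by
          refine notMem_closure_iff_nhdsWithin_eq_bot.1 ?_
          rw [isClosed_Icc.closure_eq]
          exact fun h' => absurd h'.2 (not_le.2 h)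
        simp [this]
    · rcases le_or_gt b r with h | h
      · filter_upwards [kη r ⟨h, hr.2⟩, self_mem_nhdsWithin] with s hs hs'
        simpa only [right r h, right s hs'.1] using hs
      · have : 𝓝[Set.Icc b c] r = ⊥ := by
          refine notMem_closure_iff_nhdsWithin_eq_bot.1 ?_
          rw [isClosed_Icc.closure_eq]
          exact fun h' => absurd h'.1 (not_le.2 h)
        simp [this]

/-- A chain with small steps inside `B` yields a link, if each point of `B` can be moved a little
to satisfy `Q` at any prescribed time. -/
theorem of_reflTransGen [DenselyOrdered T] {B : Set L} (hη : 0 ≤ η)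
    (hB : ∀ z ∈ B, ∀ r ∈ Set.Icc a b, ∃ w, Q r w ∧ dist w z ≤ η) {z z' : L} (hz : z ∈ B)
    (h : Relation.ReflTransGen (fun u v => v ∈ B ∧ dist u v < η) z z') :
    ∀ {c d : T} {w v : L}, a ≤ c → c < d → d ≤ b → Q c w → dist w z ≤ η → Q d v →
      dist v z' ≤ η → Linked (4 * η) Q c d w v := by
  have e4 : 4 * η = 2 * (2 * η) := by ring
  induction h using Relation.ReflTransGen.head_induction_on with
  | refl =>
    intro c d w v hc hcd hd hw hwz hv hvz
    rw [e4]
    refine of_forall_close (z := z') hcd hw hv (by linarith) (by linarith) fun r hr => ?_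
    obtain ⟨w, hw, hwz⟩ := hB z' hz r ⟨hc.trans hr.1, hr.2.trans hd⟩
    exact ⟨w, hw, by linarith⟩
  | @head u u' huu' _ ih =>
    intro c d w v hc hcd hd hw hwz hv hvz
    -- The first step of the chain is spent on `[c, m]`, where all values stay within `2 * η` of
    -- `u`; the rest of the chain is spent on `[m, d]`.
    obtain ⟨m, hcm, hmd⟩ := exists_between hcd
    obtain ⟨w', hw', hwz'⟩ := hB u' huu'.1 m ⟨hc.trans hcm.le, hmd.le.trans hd⟩
    refine trans hcm.le hmd.le (y := w') ?_ (ih huu'.1 (hc.trans hcm.le) hmd hd hw' hwz' hv hvz)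
    rw [e4]
    refine of_forall_close (z := u) hcm hw hw' (by linarith) ?_ fun r hr => ?_
    · have := dist_triangle_right w' u u'
      linarith [huu'.2]
    · obtain ⟨w, hw, hwz⟩ := hB u hz r ⟨hc.trans hr.1, (hr.2.trans hmd.le).trans hd⟩
      exact ⟨w, hw, by linarith⟩

end Linked

/-! ### Selection over the unit interval. -/

section Section

variable {L : Type*} [MetricSpace L] {F : I → Set L}

/-- Points in nearby fibres of `F` are close to each other, locally uniformly. -/
def FibersOpen (F : I → Set L) : Prop :=
  ∀ r, ∀ ε > 0, ∀ᶠ p in 𝓝 r ×ˢ 𝓝 r, ∀ x ∈ F p.1, ∃ y ∈ F p.2, dist x y ≤ ε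

/-- Points of a set are joined by chains with small steps that do not leave a ball around
the first point of radius slightly more than the distance to the second. -/
def ChainConnected (A : Set L) : Prop :=
  ∀ x ∈ A, ∀ y ∈ A, ∀ η > 0, Relation.ReflTransGen
    (fun u v => (v ∈ A ∧ dist v x ≤ dist x y + η) ∧ dist u v < η) x y

/-- On a short interval `[a, b]`, a point `y` of `F a` near `f b` is joined to `f a` by a fine chain
in `F a`, and the chain is carried to the fibres over `[a, b]`. The chain stays within `2ε + 2η` of
`f a`, carrying it costs `η`, and `f` moves by at most `2ε`; the total `4ε + 3η` is at most `7ε`. -/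
theorem exists_refinement (hopen : FibersOpen F) (hchain : ∀ r, ChainConnected (F r)) {f : I → L}
    (hf : ∀ r, f r ∈ F r) {ε η : ℝ} (hη : 0 < η) (hηε : η ≤ ε)
    (hfε : ∀ r, ∀ᶠ s in 𝓝 r, dist (f r) (f s) ≤ ε) :
    ∃ g : I → L, g 0 = f 0 ∧ g 1 = f 1 ∧ (∀ r, g r ∈ F r) ∧ (∀ r, dist (g r) (f r) ≤ 7 * ε) ∧
      ∀ r, ∀ᶠ s in 𝓝 r, dist (g r) (g s) ≤ 4 * η := by
  have hU : ∀ r, ∃ U : Set I, IsOpen U ∧ r ∈ U ∧ (∀ s ∈ U, dist (f r) (f s) ≤ ε) ∧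
      ∀ s ∈ U, ∀ t ∈ U, ∀ x ∈ F s, ∃ y ∈ F t, dist x y ≤ η := by
    intro r
    obtain ⟨V, hV, hVs⟩ := eventually_prod_self_iff'.1 (hopen r η hη)
    obtain ⟨U, hUV, hUo, hrU⟩ := mem_nhds_iff.1 (inter_mem hV (hfε r))
    exact ⟨U, hUo, hrU, fun s hs => (hUV hs).2,
      fun s hs t ht => hVs s (hUV hs).1 t (hUV ht).1⟩
  choose U hUo hrU hUf hUF using hU
  obtain ⟨t, t0, tmono, ⟨n, tn⟩, tU⟩ := exists_monotone_Icc_subset_open_cover_unitInterval hUo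
    (fun r _ => Set.mem_iUnion.2 ⟨r, hrU r⟩)
  let Q : I → L → Prop := fun r w => w ∈ F r ∧ dist w (f r) ≤ 7 * ε
  have hQf : ∀ r, Q r (f r) := fun r => ⟨hf r, by rw [dist_self]; linarith⟩
  have step : ∀ n, Linked (4 * η) Q (t n) (t (n + 1)) (f (t n)) (f (t (n + 1))) := by
    intro n
    obtain ⟨i, hi⟩ := tU n
    rcases (tmono n.le_succ).eq_or_lt with h | h
    · have h' : t (n + 1) = t n := h.symm
      rw [h']
      exact Linked.refl (by linarith) (hQf _)
    generalize t n = a at *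
    change a < t (n + 1) at h
    generalize t (n + 1) = b at *
    have ha : a ∈ U i := hi ⟨le_rfl, h.le⟩
    have hb : b ∈ U i := hi ⟨h.le, le_rfl⟩
    have hdist : ∀ r ∈ Set.Icc a b, dist (f a) (f r) ≤ 2 * ε := fun r hr => by
      have := dist_triangle_left (f a) (f r) (f i)
      linarith [hUf i a ha, hUf i r (hi hr)]
    obtain ⟨y, hy, hyb⟩ := hUF i b hb a ha (f b) (hf b)
    have hya : dist (f a) y ≤ 2 * ε + η := by
      have := dist_triangle (f a) (f b) y
      linarith [hdist b ⟨h.le, le_rfl⟩]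
    refine Linked.of_reflTransGen (a := a) (b := b) hη.le (z := f a) (z' := y)
      (B := {v | v ∈ F a ∧ dist v (f a) ≤ dist (f a) y + η}) ?_ ?_
      (hchain a _ (hf a) y hy η hη) le_rfl h le_rfl (hQf a) ?_ (hQf b) hyb
    · rintro z ⟨hz, hza⟩ r hr
      obtain ⟨w, hw, hwz⟩ := hUF i a ha r (hi hr) z hz
      rw [dist_comm] at hwz
      refine ⟨w, ⟨hw, ?_⟩, hwz⟩
      have h1 := dist_triangle w z (f r)
      have h2 := dist_triangle z (f a) (f r)
      linarith [hdist r hr]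
    · exact ⟨hf a, by rw [dist_self]; positivity⟩
    · rw [dist_self]; exact hη.le
  have all : ∀ n, Linked (4 * η) Q (t 0) (t n) (f (t 0)) (f (t n)) := by
    intro n
    induction n with
    | zero => exact Linked.refl (by linarith) (hQf _)
    | succ n ih => exact Linked.trans (tmono n.zero_le) (tmono n.le_succ) ih (step n)
  have h := all n
  rw [t0, tn n le_rfl] at h
  have huniv : Set.Icc (0 : I) 1 = Set.univ := Set.eq_univ_of_forall fun r => ⟨r.2.1, r.2.2⟩
  obtain ⟨g, g0, g1, gQ, gη⟩ := h
  rw [huniv] at gQ gη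
  refine ⟨g, g0, g1, fun r => (gQ r trivial).1, fun r => (gQ r trivial).2, fun r => ?_⟩
  simpa using gη r trivial

/-- A selection theorem for set-valued maps on the unit interval. -/
theorem exists_continuous_section [CompleteSpace L] (hbdd : ∀ x y : L, dist x y ≤ 1)
    (hclosed : ∀ r, IsClosed (F r)) (hne : ∀ r, (F r).Nonempty) (hopen : FibersOpen F)
    (hchain : ∀ r, ChainConnected (F r)) {x y : L} (hx : x ∈ F 0) (hy : y ∈ F 1) :
    ∃ g : I → L, Continuous g ∧ g 0 = x ∧ g 1 = y ∧ ∀ r, g r ∈ F r := by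
  let Stage (n : ℕ) := {f : I → L // f 0 = x ∧ f 1 = y ∧ (∀ r, f r ∈ F r) ∧
    ∀ r, ∀ᶠ s in 𝓝 r, dist (f r) (f s) ≤ (1 / 2) ^ n}
  have hnext : ∀ n (f : Stage n), ∃ g : Stage (n + 1), ∀ r,
      dist (f.1 r) (g.1 r) ≤ 7 * (1 / 2) ^ n := by
    rintro n ⟨f, f0, f1, fF, fη⟩
    -- The oscillation bound `4 * η` becomes `(1 / 2) ^ (n + 1)`.
    obtain ⟨g, g0, g1, gF, gf, gη⟩ := exists_refinement hopen hchain fF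
      (η := (1 / 2) ^ (n + 1) / 4) (by positivity)
      (by rw [pow_succ]; linarith [pow_pos (one_half_pos (α := ℝ)) n]) fη
    refine ⟨⟨g, g0.trans f0, g1.trans f1, gF, fun r => ?_⟩, fun r => by
      rw [dist_comm]; exact gf r⟩
    filter_upwards [gη r] with s hs
    linarith
  have hinit : Nonempty (Stage 0) := by
    choose f hf using hne
    -- Any selection serves as stage 0, as the whole space has diameter at most 1.
    refine ⟨⟨Function.update (Function.update f 0 x) 1 y, by simp, by simp, fun r => ?_,
      fun r => Eventually.of_forall fun s => by simpa using hbdd _ _⟩⟩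
    rcases eq_or_ne r 1 with rfl | h1
    · simpa
    rcases eq_or_ne r 0 with rfl | h0
    · simpa
    simpa [h0, h1] using hf r
  choose next hnext using hnext
  obtain ⟨f₀⟩ := hinit
  let f : ∀ n, Stage n := fun n => Nat.rec f₀ next n
  have hf : ∀ r n, dist ((f n).1 r) ((f (n + 1)).1 r) ≤ 7 * (1 / 2) ^ n := fun r n => hnext n (f n) r
  have hlim : ∀ r, ∃ z, Tendsto (fun n => (f n).1 r) atTop (𝓝 z) := fun r =>
    cauchySeq_tendsto_of_complete (cauchySeq_of_le_geometric (1 / 2) 7 (by norm_num) (hf r))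
  choose g hg using hlim
  have hfg : ∀ r n, dist ((f n).1 r) (g r) ≤ 14 * (1 / 2) ^ n := fun r n => by
    have := dist_le_of_le_geometric_of_tendsto (1 / 2) 7 (by norm_num) (hf r) (hg r) n
    norm_num at this ⊢
    linarith
  refine ⟨g, ?_, ?_, ?_, ?_⟩
  · rw [Metric.continuous_iff']
    intro r ε hε
    -- 29 = 14 + 1 + 14: twice the distance to the limit plus the oscillation at stage `n`.
    have hsmall : Tendsto (fun n : ℕ => 29 * (1 / 2 : ℝ) ^ n) atTop (𝓝 0) := by
      simpa using (tendsto_pow_atTop_nhds_zero_of_lt_one (r := (1 / 2 : ℝ)) (by norm_num)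
        (by norm_num)).const_mul 29
    obtain ⟨n, hn⟩ := (hsmall.eventually (gt_mem_nhds hε)).exists
    filter_upwards [(f n).2.2.2.2 r] with s hs
    have h1 := dist_triangle4 (g s) ((f n).1 s) ((f n).1 r) (g r)
    rw [dist_comm (g s) ((f n).1 s), dist_comm ((f n).1 s) ((f n).1 r)] at h1
    linarith [hfg s n, hfg r n]
  · exact tendsto_nhds_unique (hg 0) (tendsto_const_nhds.congr fun n => ((f n).2.1).symm)
  · exact tendsto_nhds_unique (hg 1) (tendsto_const_nhds.congr fun n => ((f n).2.2.1).symm)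
  · exact fun r => (hclosed r).mem_of_tendsto (hg r)
      (Eventually.of_forall fun n => (f n).2.2.2.1 r)

end Section

/-! ### Nonatomic measures: intermediate values, uniform variables, prescribed joint laws. -/

section Nonatomic

variable {Ω : Type*} [MeasurableSpace Ω] {μ : Measure Ω}

theorem IsNonatomic.restrict (hμ : IsNonatomic μ) {A : Set Ω} (hA : MeasurableSet A) :
    IsNonatomic (μ.restrict A) := by
  intro B hB hpos
  rw [Measure.restrict_apply hB] at hpos
  obtain ⟨D, hDB, hD, hD0, hDlt⟩ := hμ _ (hB.inter hA) hpos
  have : μ.restrict A D = μ D := by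
    rw [Measure.restrict_apply hD, Set.inter_eq_left.2 (hDB.trans Set.inter_subset_right)]
  refine ⟨D, hDB.trans Set.inter_subset_left, hD, ?_, ?_⟩
  · rwa [this]
  · rwa [this, Measure.restrict_apply hB]

/-- Equality or strict inclusion with strict inequality of measures, in either direction. -/
def MeasureComparable (μ : Measure Ω) (A B : Set Ω) : Prop :=
  A = B ∨ (A ⊆ B ∧ μ A < μ B) ∨ (B ⊆ A ∧ μ B < μ A)

theorem MeasureComparable.symm {A B : Set Ω} (h : MeasureComparable μ A B) :
    MeasureComparable μ B A := by
  rcases h with h | h | h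
  exacts [.inl h.symm, .inr (.inr h), .inr (.inl h)]

theorem MeasureComparable.subset_of_lt {A B : Set Ω} (h : MeasureComparable μ A B)
    (hlt : μ A < μ B) : A ⊆ B := by
  rcases h with h | h | h
  exacts [h.subset, h.1, absurd hlt h.2.le.not_gt]

theorem MeasureComparable.eq_of_eq {A B : Set Ω} (h : MeasureComparable μ A B)
    (he : μ A = μ B) : A = B := by
  rcases h with h | h | h
  exacts [h, absurd he h.2.ne, absurd he h.2.ne']

theorem MeasureComparable.subset_of_le {A B : Set Ω} (h : MeasureComparable μ A B)
    (hle : μ A ≤ μ B) : A ⊆ B := by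
  rcases hle.lt_or_eq with h' | h'
  exacts [h.subset_of_lt h', (h.eq_of_eq h').subset]

theorem MeasureComparable.compl [IsFiniteMeasure μ] {A B : Set Ω} (hA : MeasurableSet A)
    (hB : MeasurableSet B) (h : MeasureComparable μ A B) : MeasureComparable μ Aᶜ Bᶜ := by
  have key : ∀ {A B : Set Ω}, MeasurableSet A → MeasurableSet B → A ⊆ B ∧ μ A < μ B →
      Bᶜ ⊆ Aᶜ ∧ μ Bᶜ < μ Aᶜ := by
    intro A B hA hB h
    refine ⟨Set.compl_subset_compl.2 h.1, ?_⟩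
    refine lt_of_not_ge fun hle => ?_
    have := ENNReal.add_lt_add_of_lt_of_le (measure_ne_top _ _) h.2 hle
    rw [measure_add_measure_compl hA, measure_add_measure_compl hB] at this
    exact this.false
  rcases h with h | h | h
  · exact .inl (by rw [h])
  · exact .inr (.inr (key hA hB h))
  · exact .inr (.inl (key hB hA h))

/-- A maximal family of measurable sets which is totally ordered by inclusion and on which the
measure is injective. -/
structure IsMaxMeasureChain (μ : Measure Ω) (𝒞 : Set (Set Ω)) : Prop where
  measurableSet : ∀ A ∈ 𝒞, MeasurableSet A
  comparable : ∀ A ∈ 𝒞, ∀ B ∈ 𝒞, MeasureComparable μ A B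
  mem : ∀ A, MeasurableSet A → (∀ B ∈ 𝒞, MeasureComparable μ A B) → A ∈ 𝒞

theorem exists_isMaxMeasureChain (μ : Measure Ω) : ∃ 𝒞, IsMaxMeasureChain μ 𝒞 := by
  let r : {A : Set Ω // MeasurableSet A} → {A : Set Ω // MeasurableSet A} → Prop :=
    fun A B => MeasureComparable μ A B
  have hmax : IsMaxChain r (maxChain r) := maxChain_spec
  refine ⟨Subtype.val '' maxChain r, ?_, ?_, ?_⟩
  · rintro _ ⟨A, -, rfl⟩
    exact A.2
  · rintro _ ⟨A, hA, rfl⟩ _ ⟨B, hB, rfl⟩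
    by_cases h : A = B
    · exact .inl (by rw [h])
    · exact (hmax.1 hA hB h).elim id MeasureComparable.symm
  · intro A hA h
    have hins : IsChain r (insert ⟨A, hA⟩ (maxChain r)) :=
      hmax.1.insert fun B hB _ => .inl (h B ⟨B, hB, rfl⟩)
    exact ⟨⟨A, hA⟩, hmax.2 hins (Set.subset_insert _ _) ▸ Set.mem_insert _ _, rfl⟩

namespace IsMaxMeasureChain

variable {𝒞 : Set (Set Ω)}

theorem compl [IsFiniteMeasure μ] (h : IsMaxMeasureChain μ 𝒞) :
    IsMaxMeasureChain μ (compl ⁻¹' 𝒞) where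
  measurableSet A hA := by simpa using (h.measurableSet _ hA).compl
  comparable A hA B hB := by
    simpa using (h.comparable _ hA _ hB).compl (h.measurableSet _ hA) (h.measurableSet _ hB)
  mem A hA hcomp := h.mem _ hA.compl fun B hB => by
    simpa using (hcomp Bᶜ (by simpa using hB)).compl hA (h.measurableSet _ hB).compl

/-- The supremum of the measures not exceeding `c` is approached along an increasing sequence in the
chain. If it were not attained, the union of the sequence would be comparable with every member,
hence itself a member by maximality. -/
theorem exists_greatest_le (h : IsMaxMeasureChain μ 𝒞) (c : ℝ≥0∞) :
    ∃ B ∈ 𝒞, μ B ≤ c ∧ ∀ C ∈ 𝒞, μ C ≤ c → μ C ≤ μ B := by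
  have hne : (μ '' {C ∈ 𝒞 | μ C ≤ c}).Nonempty := by
    by_contra hemp
    have hD : ∀ C ∈ 𝒞, c < μ C := fun C hC => not_le.1 fun hc => hemp ⟨_, C, ⟨hC, hc⟩, rfl⟩
    refine hemp ⟨_, ∅, ⟨h.mem ∅ .empty fun B hB => .inr (.inl ⟨Set.empty_subset _, ?_⟩), ?_⟩, rfl⟩
    · rw [measure_empty]
      exact zero_le.trans_lt (hD B hB)
    · simp
  obtain ⟨u, umono, utend, hu⟩ := exists_seq_tendsto_sSup hne (OrderTop.bddAbove _)
  set s := sSup (μ '' {C ∈ 𝒞 | μ C ≤ c})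
  choose C hC hCu using hu
  have hle : ∀ B ∈ 𝒞, μ B ≤ c → μ B ≤ s := fun B hB hBc => le_sSup ⟨B, ⟨hB, hBc⟩, rfl⟩
  have hsc : s ≤ c := sSup_le (by rintro _ ⟨B, hB, rfl⟩; exact hB.2)
  have hCmono : Monotone C := fun m n hmn =>
    (h.comparable _ (hC m).1 _ (hC n).1).subset_of_le (by rw [hCu, hCu]; exact umono hmn)
  have hs : μ (⋃ n, C n) = s := by
    refine tendsto_nhds_unique (tendsto_measure_iUnion_atTop hCmono) ?_
    simpa only [Function.comp_def, hCu] using utend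
  by_cases hatt : ∃ B ∈ 𝒞, μ B = s
  · obtain ⟨B, hB, hBs⟩ := hatt
    exact ⟨B, hB, hBs.trans_le hsc, fun C hC hCc => (hle C hC hCc).trans hBs.ge⟩
  refine absurd ⟨_, h.mem (⋃ n, C n) (.iUnion fun n => h.measurableSet _ (hC n).1) ?_, hs⟩ hatt
  intro B hB
  rcases le_or_gt (μ B) c with hBc | hBc
  · have hlt : μ B < s := (hle B hB hBc).lt_of_ne fun e => hatt ⟨B, hB, e⟩
    obtain ⟨n, hn⟩ := (utend.eventually (lt_mem_nhds hlt)).exists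
    refine .inr (.inr ⟨?_, by rwa [hs]⟩)
    exact ((h.comparable _ hB _ (hC n).1).subset_of_lt (by rwa [hCu])).trans
      (Set.subset_iUnion C n)
  · refine .inr (.inl ⟨Set.iUnion_subset fun n => ?_, by rw [hs]; exact hsc.trans_lt hBc⟩)
    exact (h.comparable _ (hC n).1 _ hB).subset_of_lt ((hC n).2.trans_lt hBc)

/-- Dual to `exists_greatest_le`: complements of the members again form a maximal chain. -/
theorem exists_least_ge [IsFiniteMeasure μ] (h : IsMaxMeasureChain μ 𝒞) {c : ℝ≥0∞}
    (hc : c ≤ μ Set.univ) : ∃ B ∈ 𝒞, c ≤ μ B ∧ ∀ C ∈ 𝒞, c ≤ μ C → μ B ≤ μ C := by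
  obtain ⟨B, hB, hBc, hmax⟩ := h.compl.exists_greatest_le (μ Set.univ - c)
  have hBm : MeasurableSet B := h.compl.measurableSet B hB
  refine ⟨Bᶜ, hB, ?_, fun C hC hcC => ?_⟩
  · rw [measure_compl hBm (measure_ne_top _ _)]
    refine ENNReal.le_sub_of_add_le_left (measure_ne_top _ _) ?_
    calc μ B + c ≤ μ Set.univ - c + c := by gcongr
      _ = μ Set.univ := tsub_add_cancel_of_le hc
  · have hCm := h.measurableSet C hC
    have := hmax Cᶜ (by simpa using hC) (by
      rw [measure_compl hCm (measure_ne_top _ _)]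
      gcongr)
    rw [measure_compl hCm (measure_ne_top _ _), tsub_le_iff_right] at this
    rw [measure_compl hBm (measure_ne_top _ _), tsub_le_iff_left]
    exact this

/-- A missed value `c` would lie in a gap between consecutive members `B ⊆ E`. Nonatomicity splits
`E \ B`, giving a set strictly inside the gap and comparable with the whole chain, against
maximality. -/
theorem exists_measure_eq [IsFiniteMeasure μ] (h : IsMaxMeasureChain μ 𝒞) (hμ : IsNonatomic μ)
    {c : ℝ≥0∞} (hc : c ≤ μ Set.univ) : ∃ B ∈ 𝒞, μ B = c := by
  obtain ⟨B, hB, hBc, hBmax⟩ := h.exists_greatest_le c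
  obtain ⟨E, hE, hcE, hEmin⟩ := h.exists_least_ge hc
  by_contra hne
  have hBlt : μ B < c := hBc.lt_of_ne fun e => hne ⟨B, hB, e⟩
  have hltE : c < μ E := hcE.lt_of_ne fun e => hne ⟨E, hE, e.symm⟩
  have hBE : B ⊆ E := (h.comparable B hB E hE).subset_of_lt (hBlt.trans hltE)
  have hBm := h.measurableSet B hB
  have hdiff : μ E = μ B + μ (E \ B) := by
    rw [← measure_union Set.disjoint_sdiff_right ((h.measurableSet E hE).diff hBm),
      Set.union_sdiff_cancel hBE]
  obtain ⟨D, hDE, hDm, hD0, hDlt⟩ := hμ (E \ B) ((h.measurableSet E hE).diff hBm) (by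
    rw [pos_iff_ne_zero]
    intro h0
    rw [h0, add_zero] at hdiff
    exact (hBlt.trans hltE).ne hdiff.symm)
  have hBD : μ (B ∪ D) = μ B + μ D :=
    measure_union (Set.disjoint_sdiff_right.mono_right hDE) hDm
  have hB_lt : μ B < μ (B ∪ D) := by
    rw [hBD]
    exact ENNReal.lt_add_right (measure_ne_top _ _) hD0.ne'
  have hlt_E : μ (B ∪ D) < μ E := by
    rw [hBD, hdiff]
    exact ENNReal.add_lt_add_left (measure_ne_top _ _) hDlt
  have hmem : B ∪ D ∈ 𝒞 := by
    refine h.mem _ (hBm.union hDm) fun C hC => ?_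
    rcases le_total (μ C) c with hCc | hCc
    · have hle := hBmax C hC hCc
      exact .inr (.inr ⟨((h.comparable C hC B hB).subset_of_le hle).trans
        Set.subset_union_left, hle.trans_lt hB_lt⟩)
    · have hle := hEmin C hC hCc
      exact .inr (.inl ⟨(Set.union_subset hBE (hDE.trans Set.sdiff_subset)).trans
        ((h.comparable E hE C hC).subset_of_le hle), hlt_E.trans_le hle⟩)
  rcases le_total (μ (B ∪ D)) c with h' | h'
  · exact (hBmax _ hmem h').not_gt hB_lt
  · exact (hEmin _ hmem h').not_gt hlt_E

end IsMaxMeasureChain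

/-- A finite nonatomic measure carries a uniformly distributed function. -/
theorem IsNonatomic.exists_map_eq_smul_volume [IsFiniteMeasure μ] (hμ : IsNonatomic μ) :
    ∃ U : Ω → I, Measurable U ∧ μ.map U = μ Set.univ • volume := by
  rcases eq_or_ne (μ Set.univ) 0 with h0 | h0
  · refine ⟨fun _ => 0, measurable_const, ?_⟩
    rw [h0, zero_smul, Measure.measure_univ_eq_zero.1 h0, Measure.map_zero]
  obtain ⟨𝒞, h𝒞⟩ := exists_isMaxMeasureChain μ
  have hex : ∀ t : I, ∃ B ∈ 𝒞, μ B = μ Set.univ * ENNReal.ofReal t := fun t =>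
    h𝒞.exists_measure_eq hμ (mul_le_of_le_one_right zero_le (ENNReal.ofReal_le_one.2 t.2.2))
  choose B hB hBμ using hex
  have hBmono : Monotone B := fun s t hst =>
    (h𝒞.comparable _ (hB s) _ (hB t)).subset_of_le (by
      rw [hBμ, hBμ]
      gcongr)
  -- The sublevel sets of `U` are, up to null sets, the `B t`. Outside every `B t` the infimum is
  -- that of the empty set, which is 1 in `I`.
  let U : Ω → I := fun ω => sInf {t | ω ∈ B t}
  have hUlt : ∀ ω t, U ω < t ↔ ∃ s < t, ω ∈ B s := fun ω t => by
    simp only [U, sInf_lt_iff, Set.mem_ofPred_eq]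
    exact ⟨fun ⟨s, h1, h2⟩ => ⟨s, h2, h1⟩, fun ⟨s, h1, h2⟩ => ⟨s, h2, h1⟩⟩
  have hU : Measurable U := by
    refine measurable_of_Iio fun t => ?_
    obtain ⟨D, hDc, hD⟩ := TopologicalSpace.exists_countable_dense I
    have : U ⁻¹' Set.Iio t = (⋃ s ∈ D ∩ Set.Iio t, B s) := by
      ext ω
      simp only [Set.mem_preimage, Set.mem_Iio, hUlt, Set.mem_iUnion, Set.mem_inter_iff]
      constructor
      · rintro ⟨s, hst, hs⟩
        obtain ⟨d, hd, hsd, hdt⟩ := hD.exists_between hst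
        exact ⟨d, ⟨hd, hdt⟩, hBmono hsd.le hs⟩
      · rintro ⟨s, ⟨-, hst⟩, hs⟩
        exact ⟨s, hst, hs⟩
    rw [this]
    exact .biUnion (hDc.mono Set.inter_subset_left) fun s _ => h𝒞.measurableSet _ (hB s)
  refine ⟨U, hU, ?_⟩
  have : IsFiniteMeasure (μ Set.univ • (volume : Measure I)) :=
    Measure.smul_finite _ (measure_ne_top _ _)
  refine Measure.ext_of_Iic _ _ fun t => ?_
  rw [Measure.map_apply hU measurableSet_Iic, Measure.smul_apply, unitInterval.volume_Iic,
    smul_eq_mul]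
  refine le_antisymm ?_ ?_
  · rcases eq_or_ne t 1 with rfl | ht
    · simpa using measure_mono (Set.subset_univ _)
    have ht1 : t < 1 := lt_of_le_of_ne t.2.2 ht
    have : (𝓝[>] t).NeBot := nhdsGT_neBot_of_exists_gt ⟨1, ht1⟩
    have htend : Tendsto (fun s : I => μ Set.univ * ENNReal.ofReal s) (𝓝[>] t)
        (𝓝 (μ Set.univ * ENNReal.ofReal t)) :=
      (ENNReal.Tendsto.const_mul ((ENNReal.continuous_ofReal.comp continuous_subtype_val).tendsto t)
        (.inr (measure_ne_top _ _))).mono_left nhdsWithin_le_nhds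
    refine ge_of_tendsto htend ?_
    filter_upwards [self_mem_nhdsWithin] with s hs
    rw [← hBμ]
    refine measure_mono fun ω hω => ?_
    obtain ⟨s', hs', hω'⟩ := (hUlt ω s).1 (lt_of_le_of_lt hω hs)
    exact hBmono hs'.le hω'
  · rw [← hBμ]
    exact measure_mono fun ω hω => sInf_le (a := t) hω

/-- Every finite measure on a standard Borel space is the image of every nonatomic measure of the
same mass. -/
theorem IsNonatomic.exists_map_eq [IsFiniteMeasure μ] (hμ : IsNonatomic μ) {T : Type*}
    [MeasurableSpace T] [StandardBorelSpace T] [Nonempty T] (ν : Measure T)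
    (h : μ Set.univ = ν Set.univ) : ∃ Y : Ω → T, Measurable Y ∧ μ.map Y = ν := by
  rcases eq_or_ne (μ Set.univ) 0 with h0 | h0
  · refine ⟨fun _ => Classical.arbitrary T, measurable_const, ?_⟩
    rw [Measure.measure_univ_eq_zero.1 h0, Measure.map_zero,
      Measure.measure_univ_eq_zero.1 (h.symm.trans h0)]
  obtain ⟨U, hU, hUμ⟩ := hμ.exists_map_eq_smul_volume
  have : IsProbabilityMeasure ((μ Set.univ)⁻¹ • ν) := ⟨by
    rw [Measure.smul_apply, ← h, smul_eq_mul, ENNReal.inv_mul_cancel h0 (measure_ne_top _ _)]⟩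
  obtain ⟨f, hf, hfν⟩ := Measure.exists_measurable_map_eq ((μ Set.univ)⁻¹ • ν)
  refine ⟨f ∘ U, hf.comp hU, ?_⟩
  rw [← Measure.map_map hf hU, hUμ, Measure.map_smul, hfν, smul_smul,
    ENNReal.mul_inv_cancel h0 (measure_ne_top _ _), one_smul]

theorem measure_eq_tsum_inter_preimage_singleton {ι : Type*} [Countable ι] [MeasurableSpace ι]
    [MeasurableSingletonClass ι] (μ : Measure Ω) {f : Ω → ι} (hf : Measurable f) {s : Set Ω}
    (hs : MeasurableSet s) : μ s = ∑' i, μ (s ∩ f ⁻¹' {i}) := by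
  rw [← measure_iUnion]
  · congr 1
    ext ω
    simp
  · intro i j hij
    refine Set.disjoint_left.2 fun ω hi hj => hij ?_
    exact hi.2.symm.trans hj.2
  · exact fun i => hs.inter (hf (measurableSet_singleton i))

/-- On a nonatomic space, a random variable with countably many values can be complemented to a
pair with any given joint law whose first marginal is right. -/
theorem IsNonatomic.exists_map_prodMk_eq [IsFiniteMeasure μ] (hμ : IsNonatomic μ) {ι T : Type*}
    [Countable ι] [MeasurableSpace ι] [MeasurableSingletonClass ι] [MeasurableSpace T]
    [StandardBorelSpace T] [Nonempty T] {f : Ω → ι} (hf : Measurable f) (Γ : Measure (ι × T))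
    (hΓ : Γ.fst = μ.map f) :
    ∃ Y : Ω → T, Measurable Y ∧ μ.map (fun ω => (f ω, Y ω)) = Γ := by
  have hmeas : ∀ i, MeasurableSet (f ⁻¹' {i}) := fun i => hf (measurableSet_singleton i)
  -- On each event `f = i` the restricted measure is still nonatomic, so it can be mapped onto the
  -- slice of `Γ` over `i`; the pieces are then glued.
  have hex : ∀ i, ∃ Y : Ω → T, Measurable Y ∧ (μ.restrict (f ⁻¹' {i})).map Y =
      (Γ.restrict (Prod.fst ⁻¹' {i})).map Prod.snd := by
    intro i
    refine (hμ.restrict (hmeas i)).exists_map_eq _ ?_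
    rw [Measure.map_apply measurable_snd .univ, Set.preimage_univ, Measure.restrict_apply_univ,
      Measure.restrict_apply_univ, ← Measure.map_apply hf (measurableSet_singleton i), ← hΓ,
      Measure.fst_apply (measurableSet_singleton i)]
  choose Y hY hYΓ using hex
  have hYm : Measurable fun ω => Y (f ω) ω :=
    (measurable_from_prod_countable_right (f := fun p : ι × Ω => Y p.1 p.2) hY).comp
      (hf.prodMk measurable_id)
  refine ⟨fun ω => Y (f ω) ω, hYm, Measure.ext fun s hs => ?_⟩
  rw [Measure.map_apply (hf.prodMk hYm) hs, measure_eq_tsum_inter_preimage_singleton μ hf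
    ((hf.prodMk hYm) hs), measure_eq_tsum_inter_preimage_singleton Γ measurable_fst hs]
  refine tsum_congr fun i => ?_
  have hsi : MeasurableSet (Prod.mk i ⁻¹' s) := measurable_prodMk_left hs
  have h := congrArg (fun m => m (Prod.mk i ⁻¹' s)) (hYΓ i)
  simp only [Measure.map_apply (hY i) hsi, Measure.map_apply measurable_snd hsi,
    Measure.restrict_apply (hY i hsi), Measure.restrict_apply (measurable_snd hsi)] at h
  convert h using 2
  · ext ω
    simp only [Set.mem_inter_iff, Set.mem_preimage, Set.mem_singleton_iff]
    constructor <;> rintro ⟨h1, rfl⟩ <;> exact ⟨h1, rfl⟩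
  · ext ⟨j, t⟩
    simp only [Set.mem_inter_iff, Set.mem_preimage, Set.mem_singleton_iff]
    constructor <;> rintro ⟨h1, rfl⟩ <;> exact ⟨h1, rfl⟩

end Nonatomic

/-! ### Completeness of `L⁰` and continuity of the law. -/

namespace RandomVar

variable {Ω : Type*} [MeasurableSpace Ω] {P : Measure Ω} {S : Type*} [MetricSpace S]

/-- The class of a measurable function. -/
noncomputable def ofMeasurable [MeasurableSpace S] [BorelSpace S]
    [SecondCountableTopology S] (f : Ω → S) (hf : Measurable f) : RandomVar P S :=
  AEEqFun.mk f hf.aestronglyMeasurable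

theorem coeFn_ofMeasurable [MeasurableSpace S] [BorelSpace S] [SecondCountableTopology S]
    {f : Ω → S} (hf : Measurable f) :
    (ofMeasurable (P := P) f hf).toAEEqFun =ᵐ[P] f :=
  AEEqFun.coeFn_mk f _

variable [IsProbabilityMeasure P]

theorem dist_le_of_measure_le {X Y : RandomVar P S} {ε : ℝ} (hε : 0 < ε)
    (h : P {ω | ε ≤ dist (X.toAEEqFun ω) (Y.toAEEqFun ω)} ≤ ENNReal.ofReal ε) : dist X Y ≤ ε :=
  kyFan_le_of_mem ⟨hε, h⟩

theorem measure_le_of_dist_lt {X Y : RandomVar P S} {ε : ℝ} (h : dist X Y < ε) :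
    P {ω | ε ≤ dist (X.toAEEqFun ω) (Y.toAEEqFun ω)} ≤ ENNReal.ofReal ε :=
  (mem_kyFanSet_of_lt h).2

theorem dist_le_one (X Y : RandomVar P S) : dist X Y ≤ 1 :=
  dist_le_of_measure_le one_pos (by simpa using prob_le_one)

theorem tendsto_iff_tendstoInMeasure {κ : Type*} {l : Filter κ} {X : κ → RandomVar P S}
    {Y : RandomVar P S} : Tendsto X l (𝓝 Y) ↔
      TendstoInMeasure P (fun k => ⇑(X k).toAEEqFun) l Y.toAEEqFun := by
  rw [tendstoInMeasure_iff_dist, tendsto_iff_dist_tendsto_zero]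
  constructor
  · intro h ε hε
    rw [ENNReal.tendsto_nhds_zero]
    intro δ hδ
    obtain ⟨c, hc0, hcδ⟩ := ENNReal.lt_iff_exists_nnreal_btwn.1 hδ
    have hc : (0 : ℝ) < c := by exact_mod_cast hc0
    filter_upwards [h.eventually (gt_mem_nhds (lt_min hε hc))] with k hk
    calc P {ω | ε ≤ dist ((X k).toAEEqFun ω) (Y.toAEEqFun ω)}
        ≤ P {ω | min ε c ≤ dist ((X k).toAEEqFun ω) (Y.toAEEqFun ω)} :=
          measure_mono fun ω (hω : ε ≤ _) => (min_le_left ε (c : ℝ)).trans hω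
      _ ≤ ENNReal.ofReal (min ε c) := measure_le_of_dist_lt hk
      _ ≤ ENNReal.ofReal c := ENNReal.ofReal_le_ofReal (min_le_right _ _)
      _ = c := ENNReal.ofReal_coe_nnreal
      _ ≤ δ := hcδ.le
  · intro h
    refine Metric.tendsto_nhds.2 fun ε hε => ?_
    have hε2 := half_pos hε
    filter_upwards [(ENNReal.tendsto_nhds_zero.1 (h (ε / 2) hε2)) _ (ENNReal.ofReal_pos.2 hε2)]
      with k hk
    rw [Real.dist_0_eq_abs, abs_of_nonneg dist_nonneg]
    linarith [dist_le_of_measure_le hε2 hk]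

/-- For a fast Cauchy sequence, Borel–Cantelli gives almost sure convergence, which implies
convergence in probability. -/
instance [CompleteSpace S] : CompleteSpace (RandomVar P S) := by
  refine Metric.complete_of_convergent_controlled_sequences (fun n => (1 / 2) ^ n)
    (fun n => by positivity) fun u hu => ?_
  have hsum : (∑' n, P {ω | (1 / 2 : ℝ) ^ n ≤
      dist ((u n).toAEEqFun ω) ((u (n + 1)).toAEEqFun ω)}) ≠ ∞ := by
    refine ne_top_of_le_ne_top ?_ (ENNReal.tsum_le_tsum fun n =>
      measure_le_of_dist_lt (hu n n (n + 1) le_rfl n.le_succ))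
    exact summable_geometric_two.tsum_ofReal_ne_top
  have hlim : ∀ᵐ ω ∂P, ∃ z, Tendsto (fun n => (u n).toAEEqFun ω) atTop (𝓝 z) := by
    filter_upwards [ae_eventually_notMem hsum] with ω hω
    obtain ⟨N, hN⟩ := eventually_atTop.1 hω
    have hc : CauchySeq fun n => (u (n + N)).toAEEqFun ω := by
      refine cauchySeq_of_le_geometric (1 / 2) 1 (by norm_num) fun n => ?_
      have h := hN (n + N) (Nat.le_add_left N n)
      replace h := not_le.1 h
      have e : n + 1 + N = n + N + 1 := by ring
      rw [e, one_mul]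
      exact h.le.trans (pow_le_pow_of_le_one (by norm_num) (by norm_num) (Nat.le_add_right n N))
    obtain ⟨z, hz⟩ := cauchySeq_tendsto_of_complete hc
    exact ⟨z, (tendsto_add_atTop_iff_nat N).1 hz⟩
  obtain ⟨g, hg, hgl⟩ := exists_stronglyMeasurable_limit_of_tendsto_ae
    (fun n => (u n).toAEEqFun.aestronglyMeasurable) hlim
  refine ⟨AEEqFun.mk g hg.aestronglyMeasurable, tendsto_iff_tendstoInMeasure.2 ?_⟩
  refine tendstoInMeasure_of_tendsto_ae (fun n => (u n).toAEEqFun.aestronglyMeasurable) ?_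
  filter_upwards [hgl, AEEqFun.coeFn_mk g hg.aestronglyMeasurable] with ω h1 h2
  simp only [toAEEqFun]
  rwa [h2]

variable [MeasurableSpace S] [BorelSpace S]

theorem continuous_law : Continuous (law : RandomVar P S → ProbabilityMeasure S) := by
  refine continuous_iff_continuousAt.2 fun X => ?_
  have h := tendsto_iff_tendstoInMeasure.1 (tendsto_id (x := 𝓝 X))
  exact (h.tendstoInDistribution fun Y => Y.toAEEqFun.aemeasurable).tendsto

theorem isClosed_setOf_law_eq (ν : ProbabilityMeasure S) :
    IsClosed {X : RandomVar P S | X.law = ν} :=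
  isClosed_eq continuous_law continuous_const

theorem law_eq_iff {X : RandomVar P S} {ν : ProbabilityMeasure S} :
    X.law = ν ↔ P.map X.toAEEqFun = ν :=
  Subtype.ext_iff

variable [SecondCountableTopology S]

theorem law_ofMeasurable_eq_iff {f : Ω → S} (hf : Measurable f) {ν : ProbabilityMeasure S} :
    (ofMeasurable (P := P) f hf).law = ν ↔ P.map f = ν := by
  rw [law_eq_iff, Measure.map_congr (coeFn_ofMeasurable hf)]

end RandomVar

/-! ### Small partitions of `S` and couplings of discrete laws. -/

/-- A separable metric space has a countable partition into small pieces with null frontiers. -/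
theorem exists_measurable_label {S : Type*} [MetricSpace S] [SecondCountableTopology S]
    [MeasurableSpace S] [BorelSpace S] (ν : Measure S) [IsFiniteMeasure ν] {ε : ℝ} (hε : 0 < ε) :
    ∃ ℓ : S → ℕ, Measurable ℓ ∧ (∀ x y, ℓ x = ℓ y → dist x y < ε) ∧
      ∀ n, ν (frontier (ℓ ⁻¹' {n})) = 0 := by
  rcases isEmpty_or_nonempty S with _ | _
  · exact ⟨fun _ => 0, measurable_const, fun x => isEmptyElim x, fun n => by
      rw [Measure.eq_zero_of_isEmpty ν]; simp⟩
  -- Radii above `ε / 4` make the balls cover, radii below `ε / 2` give diameter below `ε`. The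
  -- label of a point is the index of the first ball containing it.
  have hex : ∀ n, ∃ r ∈ Set.Ioo (ε / 4) (ε / 2),
      ν (frontier (Metric.thickening r {TopologicalSpace.denseSeq S n})) = 0 := fun n =>
    exists_null_frontier_thickening ν _ (by linarith)
  choose r hr hν using hex
  set B : ℕ → Set S := fun n => Metric.thickening (r n) {TopologicalSpace.denseSeq S n} with hB
  have hmem : ∀ x n, x ∈ B n ↔ dist x (TopologicalSpace.denseSeq S n) < r n := fun x n => by
    simp [hB]
  have hcover : ∀ x, ∃ n, x ∈ B n := fun x => by
    obtain ⟨n, hn⟩ := (TopologicalSpace.denseRange_denseSeq S).exists_dist_lt x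
      (show 0 < ε / 4 by linarith)
    exact ⟨n, (hmem x n).2 (hn.trans (hr n).1)⟩
  classical
  have hpre : ∀ n, (fun x => Nat.find (hcover x)) ⁻¹' {n} = B n ∩ {x | ∀ k < n, x ∉ B k} := by
    intro n
    ext x
    simp [Nat.find_eq_iff]
  have hsucc : ∀ n, {x | ∀ k < n + 1, x ∉ B k} = {x | ∀ k < n, x ∉ B k} ∩ (B n)ᶜ := by
    intro n
    ext x
    simp only [Set.mem_ofPred_eq, Set.mem_inter_iff, Set.mem_compl_iff, Nat.lt_succ_iff_lt_or_eq]
    constructor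
    · exact fun h => ⟨fun k hk => h k (.inl hk), h n (.inr rfl)⟩
    · rintro ⟨h1, h2⟩ k (hk | rfl)
      exacts [h1 k hk, h2]
  have hA : ∀ n, MeasurableSet {x | ∀ k < n, x ∉ B k} ∧
      ν (frontier {x | ∀ k < n, x ∉ B k}) = 0 := by
    intro n
    induction n with
    | zero => simp
    | succ n ih =>
      rw [hsucc]
      refine ⟨ih.1.inter Metric.isOpen_thickening.measurableSet.compl,
        null_frontier_inter ih.2 ?_⟩
      rw [frontier_compl]
      exact hν n
  refine ⟨fun x => Nat.find (hcover x), measurable_to_countable' fun n => ?_, fun x y hxy => ?_,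
    fun n => ?_⟩
  · rw [hpre]
    exact Metric.isOpen_thickening.measurableSet.inter (hA n).1
  · have hx := (hmem _ _).1 (Nat.find_spec (hcover x))
    have hy := (hmem _ _).1 (Nat.find_spec (hcover y))
    simp only at hxy
    rw [← hxy] at hy
    have := dist_triangle_right x y (TopologicalSpace.denseSeq S (Nat.find (hcover x)))
    linarith [(hr (Nat.find (hcover x))).2]
  · rw [hpre]
    exact null_frontier_inter (hν n) (hA n).2

/-- A coupling of two discrete probability measures that puts at least the minimum of the point
masses on the diagonal. -/
theorem exists_coupling {ι : Type*} [Countable ι] [MeasurableSpace ι] [MeasurableSingletonClass ι]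
    (p q : Measure ι) [IsProbabilityMeasure p] [IsProbabilityMeasure q] :
    ∃ Γ : Measure (ι × ι), Γ.fst = p ∧ Γ.snd = q ∧
      ∀ i, min (p {i}) (q {i}) ≤ Γ {(i, i)} := by
  set m : Measure ι := Measure.sum fun i => min (p {i}) (q {i}) • Measure.dirac i with hm
  have hmi : ∀ i, m {i} = min (p {i}) (q {i}) := fun i => by
    rw [hm, Measure.sum_smul_dirac_singleton]
  have hle : ∀ r : Measure ι, (∀ i, m {i} ≤ r {i}) → m ≤ r := fun r h => by
    rw [← Measure.sum_smul_dirac m, ← Measure.sum_smul_dirac r]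
    refine Measure.le_iff.2 fun s hs => ?_
    rw [Measure.sum_apply _ hs, Measure.sum_apply _ hs]
    refine ENNReal.tsum_le_tsum fun i => ?_
    simp only [Measure.smul_apply, smul_eq_mul]
    exact mul_le_mul' (h i) le_rfl
  have hmp : m ≤ p := hle p fun i => (hmi i).trans_le (min_le_left _ _)
  have hmq : m ≤ q := hle q fun i => (hmi i).trans_le (min_le_right _ _)
  have : IsFiniteMeasure m := isFiniteMeasure_of_le p hmp
  have hp : p - m + m = p := Measure.sub_add_cancel_of_le hmp
  have hq : q - m + m = q := Measure.sub_add_cancel_of_le hmq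
  set p' := p - m
  set q' := q - m
  have : IsFiniteMeasure p' := isFiniteMeasure_of_le p (hp ▸ Measure.le_add_right le_rfl)
  have : IsFiniteMeasure q' := isFiniteMeasure_of_le q (hq ▸ Measure.le_add_right le_rfl)
  have hmass : p' Set.univ = q' Set.univ := by
    have h1 := congrArg (fun r => r Set.univ) hp
    have h2 := congrArg (fun r => r Set.univ) hq
    simp only [Measure.add_apply, measure_univ] at h1 h2
    exact (ENNReal.add_left_inj (measure_ne_top m _)).1 (h1.trans h2.symm)
  -- If the residual mass is 0, its inverse is `∞` and the product is 0, but then `r` is zero as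
  -- well.
  have hcancel : ∀ r : Measure ι, r Set.univ = p' Set.univ →
      ((p' Set.univ)⁻¹ * p' Set.univ) • r = r := by
    intro r hr
    rcases eq_or_ne (p' Set.univ) 0 with h0 | h0
    · rw [Measure.measure_univ_eq_zero.1 (hr.trans h0), smul_zero]
    · rw [ENNReal.inv_mul_cancel h0 (measure_ne_top _ _), one_smul]
  have hdiag : Measurable fun i : ι => (i, i) := measurable_id.prodMk measurable_id
  -- The common part `m` sits on the diagonal; the residuals, of equal mass, are coupled by their
  -- normalised product.
  refine ⟨m.map (fun i => (i, i)) + (p' Set.univ)⁻¹ • p'.prod q', ?_, ?_, fun i => ?_⟩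
  · rw [Measure.fst_add, Measure.fst, Measure.map_map measurable_fst hdiag, Measure.fst,
      Measure.map_smul, Measure.map_fst_prod, smul_smul, ← hmass, hcancel _ rfl]
    conv_rhs => rw [← hp, add_comm]
    congr 1
    exact Measure.map_id
  · rw [Measure.snd_add, Measure.snd, Measure.map_map measurable_snd hdiag, Measure.snd,
      Measure.map_smul, Measure.map_snd_prod, smul_smul, hcancel _ hmass.symm]
    conv_rhs => rw [← hq, add_comm]
    congr 1
    exact Measure.map_id
  · rw [← hmi, Measure.add_apply, Measure.map_apply hdiag (measurableSet_singleton _)]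
    refine le_add_right (measure_mono ?_)
    rintro _ rfl
    rfl

/-! ### The fibres of the law map. -/

namespace RandomVar

variable {Ω : Type*} [MeasurableSpace Ω] {P : Measure Ω} [IsProbabilityMeasure P]
  {S : Type*} [MetricSpace S] [MeasurableSpace S] [BorelSpace S]

theorem map_label_of_law_eq {X : RandomVar P S} {ν : ProbabilityMeasure S} (h : X.law = ν)
    {ℓ : S → ℕ} (hℓ : Measurable ℓ) : P.map (ℓ ∘ X.toAEEqFun) = (ν : Measure S).map ℓ := by
  rw [← law_eq_iff.1 h, Measure.map_map hℓ X.toAEEqFun.measurable]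

variable [SecondCountableTopology S] [CompleteSpace S]

/-- The label `f` is completed to a pair distributed as `(ℓ x, x)` under `ν`. Constructions can thus
be made on labels alone and lifted afterwards. -/
theorem exists_law_eq_of_label (hP : IsNonatomic P) (ν : ProbabilityMeasure S) {ℓ : S → ℕ}
    (hℓ : Measurable ℓ) {f : Ω → ℕ} (hf : Measurable f)
    (h : P.map f = (ν : Measure S).map ℓ) :
    ∃ Z : RandomVar P S, Z.law = ν ∧ ∀ᵐ ω ∂P, ℓ (Z.toAEEqFun ω) = f ω := by
  have : Nonempty S := Measure.nonempty_of_neZero (ν : Measure S)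
  have hpair : Measurable fun x : S => (ℓ x, x) := hℓ.prodMk measurable_id
  obtain ⟨Y, hY, hYΓ⟩ := hP.exists_map_prodMk_eq hf ((ν : Measure S).map fun x => (ℓ x, x))
    (by rw [h, Measure.fst, Measure.map_map measurable_fst hpair]; rfl)
  have hfY : Measurable fun ω => (f ω, Y ω) := hf.prodMk hY
  refine ⟨ofMeasurable Y hY, (law_ofMeasurable_eq_iff hY).2 ?_, ?_⟩
  · have := congrArg (Measure.map Prod.snd) hYΓ
    rw [Measure.map_map measurable_snd hfY, Measure.map_map measurable_snd hpair] at this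
    exact this.trans Measure.map_id
  · have hs : MeasurableSet {p : ℕ × S | ℓ p.2 = p.1} :=
      measurableSet_eq_fun (hℓ.comp measurable_snd) measurable_fst
    have h1 : ∀ᵐ p ∂P.map (fun ω => (f ω, Y ω)), ℓ p.2 = p.1 := by
      rw [hYΓ, ae_map_iff hpair.aemeasurable hs]
      exact Eventually.of_forall fun _ => rfl
    rw [ae_map_iff hfY.aemeasurable hs] at h1
    filter_upwards [h1, coeFn_ofMeasurable (P := P) hY] with ω h2 h3
    rw [h3, h2]

theorem exists_law_eq (hP : IsNonatomic P) (ν : ProbabilityMeasure S) :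
    ∃ Z : RandomVar P S, Z.law = ν := by
  have : Nonempty S := Measure.nonempty_of_neZero (ν : Measure S)
  obtain ⟨Y, hY, hYν⟩ := hP.exists_map_eq (ν : Measure S) (by simp)
  exact ⟨ofMeasurable Y hY, (law_ofMeasurable_eq_iff hY).2 hYν⟩

/-- The label of `X` is extended to a coupling with the label law of `ν'`, and the second label is
lifted to `Y`. Labels agree with probability at least `1 - ε`, and there the values are less than
`ε` apart. -/
theorem exists_dist_le_of_sum_min (hP : IsNonatomic P) {ν ν' : ProbabilityMeasure S}
    {ℓ : S → ℕ} (hℓ : Measurable ℓ) {ε : ℝ} (hε : 0 < ε)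
    (hdist : ∀ x y, ℓ x = ℓ y → dist x y < ε) {n : ℕ}
    (hsum : 1 - ENNReal.ofReal ε ≤ ∑ i ∈ Finset.range n,
      min ((ν : Measure S) (ℓ ⁻¹' {i})) ((ν' : Measure S) (ℓ ⁻¹' {i})))
    {X : RandomVar P S} (hX : X.law = ν) : ∃ Y : RandomVar P S, Y.law = ν' ∧ dist X Y ≤ ε := by
  have := Measure.isProbabilityMeasure_map (μ := (ν : Measure S)) hℓ.aemeasurable
  have := Measure.isProbabilityMeasure_map (μ := (ν' : Measure S)) hℓ.aemeasurable
  obtain ⟨Γ, hΓ₁, hΓ₂, hΓ⟩ := exists_coupling ((ν : Measure S).map ℓ) ((ν' : Measure S).map ℓ)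
  have hf : Measurable (ℓ ∘ X.toAEEqFun) := hℓ.comp X.toAEEqFun.measurable
  obtain ⟨f', hf', hff'⟩ := hP.exists_map_prodMk_eq hf Γ
    (by rw [hΓ₁, map_label_of_law_eq hX hℓ])
  have hpair := hf.prodMk hf'
  obtain ⟨Y, hY, hYf⟩ := exists_law_eq_of_label hP ν' hℓ hf' (by
    rw [← hΓ₂, ← hff', Measure.snd, Measure.map_map measurable_snd hpair]
    rfl)
  refine ⟨Y, hY, dist_le_of_measure_le hε ?_⟩
  have hdiag : MeasurableSet {p : ℕ × ℕ | p.1 = p.2} := .of_discrete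
  have hΓprob : IsProbabilityMeasure Γ :=
    hff' ▸ Measure.isProbabilityMeasure_map hpair.aemeasurable
  calc P {ω | ε ≤ dist (X.toAEEqFun ω) (Y.toAEEqFun ω)}
      ≤ P ((fun ω => ((ℓ ∘ X.toAEEqFun) ω, f' ω)) ⁻¹' {p | p.1 = p.2}ᶜ) := by
        refine measure_mono_ae ?_
        filter_upwards [hYf] with ω hω hd heq
        exact (hdist _ _ (heq.trans hω.symm)).not_ge hd
    _ = Γ {p | p.1 = p.2}ᶜ := by rw [← hff', Measure.map_apply hpair hdiag.compl]
    _ = 1 - Γ {p | p.1 = p.2} := prob_compl_eq_one_sub hdiag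
    _ ≤ ENNReal.ofReal ε := by
        rw [tsub_le_iff_left, ← tsub_le_iff_right]
        refine hsum.trans ?_
        calc ∑ i ∈ Finset.range n,
              min ((ν : Measure S) (ℓ ⁻¹' {i})) ((ν' : Measure S) (ℓ ⁻¹' {i}))
            ≤ ∑ i ∈ Finset.range n, Γ {(i, i)} := by
              refine Finset.sum_le_sum fun i _ => le_trans ?_ (hΓ i)
              rw [Measure.map_apply hℓ (measurableSet_singleton i),
                Measure.map_apply hℓ (measurableSet_singleton i)]
          _ = Γ (⋃ i ∈ Finset.range n, {(i, i)}) := by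
              refine (measure_biUnion_finset ?_ fun i _ => measurableSet_singleton _).symm
              intro i _ j _ hij
              simp [hij]
          _ ≤ Γ {p | p.1 = p.2} := by
              refine measure_mono (Set.iUnion₂_subset fun i _ => ?_)
              rintro _ rfl
              rfl

/-- Pieces with null frontier have masses continuous along `α` at `r`, and finitely many of them
carry mass above `1 - ε`. The resulting bound involves only the laws, so it is uniform in `X`. -/
theorem fibersOpen_law (hP : IsNonatomic P) {α : I → ProbabilityMeasure S} (hα : Continuous α) :
    FibersOpen fun r => {X : RandomVar P S | X.law = α r} := by
  intro r ε hε
  obtain ⟨ℓ, hℓ, hdist, hfr⟩ := exists_measurable_label (α r : Measure S) hε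
  have htend : ∀ i, Tendsto (fun s => (α s : Measure S) (ℓ ⁻¹' {i})) (𝓝 r)
      (𝓝 ((α r : Measure S) (ℓ ⁻¹' {i}))) := fun i =>
    ProbabilityMeasure.tendsto_measure_of_null_frontier_of_tendsto' (hα.tendsto r) (hfr i)
  have htsum : ∑' i, (α r : Measure S) (ℓ ⁻¹' {i}) = 1 := by
    have := measure_eq_tsum_inter_preimage_singleton (α r : Measure S) hℓ .univ
    simpa using this.symm
  obtain ⟨n, hn⟩ : ∃ n, 1 - ENNReal.ofReal ε <
      ∑ i ∈ Finset.range n, (α r : Measure S) (ℓ ⁻¹' {i}) := by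
    have h := ENNReal.tendsto_nat_tsum fun i => (α r : Measure S) (ℓ ⁻¹' {i})
    rw [htsum] at h
    refine (h.eventually (lt_mem_nhds ?_)).exists
    exact ENNReal.sub_lt_self ENNReal.one_ne_top one_ne_zero (ENNReal.ofReal_pos.2 hε).ne'
  have hmin : Tendsto (fun p : I × I => ∑ i ∈ Finset.range n,
      min ((α p.1 : Measure S) (ℓ ⁻¹' {i})) ((α p.2 : Measure S) (ℓ ⁻¹' {i}))) (𝓝 r ×ˢ 𝓝 r)
      (𝓝 (∑ i ∈ Finset.range n, (α r : Measure S) (ℓ ⁻¹' {i}))) := by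
    refine tendsto_finsetSum _ fun i _ => ?_
    simpa using ((htend i).comp tendsto_fst).min ((htend i).comp tendsto_snd)
  filter_upwards [hmin.eventually (lt_mem_nhds hn)] with p hp X hX
  exact exists_dist_le_of_sum_min hP hℓ hε hdist hp.le hX

/-- Random variables with the same law are joined by a family of random variables with that law
whose values stay close to the values of the two. -/
theorem exists_mixtures (hP : IsNonatomic P) {ν : ProbabilityMeasure S} {X Y : RandomVar P S}
    (hX : X.law = ν) (hY : Y.law = ν) {ε : ℝ} (hε : 0 < ε) :
    ∃ Z : I → RandomVar P S, Z 0 = X ∧ Z 1 = Y ∧ (∀ u, (Z u).law = ν) ∧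
      (∀ u, dist (Z u) X ≤ dist X Y + 2 * ε) ∧
      ∀ u v : I, |(u : ℝ) - v| ≤ ε → dist (Z u) (Z v) ≤ ε := by
  obtain ⟨ℓ, hℓ, hdist, -⟩ := exists_measurable_label (ν : Measure S) hε
  set x : Ω → ℕ := ℓ ∘ X.toAEEqFun with hx
  set y : Ω → ℕ := ℓ ∘ Y.toAEEqFun with hy
  have hxm : Measurable x := hℓ.comp X.toAEEqFun.measurable
  have hym : Measurable y := hℓ.comp Y.toAEEqFun.measurable
  have hxy : Measurable fun ω => (x ω, y ω) := hxm.prodMk hym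
  -- `U` is uniform and independent of the pair of labels; independence of `X` and `Y` themselves is
  -- not required.
  obtain ⟨U, hU, hUΓ⟩ := hP.exists_map_prodMk_eq hxy
    ((P.map fun ω => (x ω, y ω)).prod (volume : Measure I)) (by
      rw [Measure.fst_prod])
  have hrect : ∀ (s : Set (ℕ × ℕ)) (t : Set I), MeasurableSet t →
      P ((fun ω => (x ω, y ω)) ⁻¹' s ∩ U ⁻¹' t) = P ((fun ω => (x ω, y ω)) ⁻¹' s) * volume t := by
    intro s t ht
    have hs : MeasurableSet s := .of_discrete
    rw [← Measure.map_apply hxy hs, ← Measure.prod_prod, ← hUΓ,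
      Measure.map_apply (hxy.prodMk hU) (hs.prod ht)]
    rfl
  have hUmap : ∀ t, MeasurableSet t → P (U ⁻¹' t) = volume t := fun t ht => by
    simpa using hrect Set.univ t ht
  let g : I → Ω → ℕ := fun u ω => if U ω ≤ u then y ω else x ω
  have hg : ∀ u, Measurable (g u) := fun u => Measurable.ite (hU measurableSet_Iic) hym hxm
  have hglaw : ∀ u, P.map (g u) = (ν : Measure S).map ℓ := by
    intro u
    refine Measure.ext_of_singleton fun i => ?_
    have hi := measurableSet_singleton i
    have e : g u ⁻¹' {i} =
        ((fun ω => (x ω, y ω)) ⁻¹' {p | p.2 = i} ∩ U ⁻¹' Set.Iic u) ∪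
        ((fun ω => (x ω, y ω)) ⁻¹' {p | p.1 = i} ∩ U ⁻¹' (Set.Iic u)ᶜ) := by
      ext ω
      by_cases h : U ω ≤ u
      · simp [g, h]
      · simp [g, h, not_le.1 h]
    have hx' : P ((fun ω => (x ω, y ω)) ⁻¹' {p | p.1 = i}) = (ν : Measure S).map ℓ {i} := by
      rw [← map_label_of_law_eq hX hℓ, Measure.map_apply hxm hi]
      rfl
    have hy' : P ((fun ω => (x ω, y ω)) ⁻¹' {p | p.2 = i}) = (ν : Measure S).map ℓ {i} := by
      rw [← map_label_of_law_eq hY hℓ, Measure.map_apply hym hi]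
      rfl
    rw [Measure.map_apply (hg u) hi, e, measure_union, hrect _ _ measurableSet_Iic,
      hrect _ _ measurableSet_Iic.compl, hx', hy', ← mul_add,
      measure_add_measure_compl measurableSet_Iic, measure_univ, mul_one]
    · exact (Disjoint.preimage U disjoint_compl_right).mono Set.inter_subset_right
        Set.inter_subset_right
    · exact (hxy .of_discrete).inter (hU measurableSet_Iic.compl)
  have hex : ∀ u, ∃ Z : RandomVar P S, (u = 0 → Z = X) ∧ (u = 1 → Z = Y) ∧ Z.law = ν ∧
      ∀ᵐ ω ∂P, ℓ (Z.toAEEqFun ω) = g u ω := by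
    intro u
    by_cases h0 : u = 0
    · refine ⟨X, fun _ => rfl, fun h1 => absurd (h0.symm.trans h1) zero_ne_one, hX, ?_⟩
      -- The label `g 0` differs from `x` only on the null event `U = 0`, so `X` itself can serve as
      -- `Z 0`.
      have hU0 : ∀ᵐ ω ∂P, U ω ∉ ({0} : Set I) := by
        rw [ae_iff]
        simp only [not_not]
        exact (hUmap {0} (measurableSet_singleton 0)).trans (measure_singleton 0)
      filter_upwards [hU0] with ω hω
      have : ¬ U ω ≤ u := by
        rw [h0]
        exact fun h => hω (le_antisymm h (U ω).2.1)
      simp [g, this, hx]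
    by_cases h1 : u = 1
    · refine ⟨Y, fun h => absurd h h0, fun _ => rfl, hY, Eventually.of_forall fun ω => ?_⟩
      have : U ω ≤ u := by
        rw [h1]
        exact (U ω).2.2
      simp [g, this, hy]
    obtain ⟨Z, hZ, hZg⟩ := exists_law_eq_of_label hP ν hℓ (hg u) (hglaw u)
    exact ⟨Z, fun h => absurd h h0, fun h => absurd h h1, hZ, hZg⟩
  choose Z hZ0 hZ1 hZ hZg using hex
  have hclose : ∀ u v : I, u ≤ v → (v : ℝ) - u ≤ ε → dist (Z u) (Z v) ≤ ε := by
    intro u v huv h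
    refine dist_le_of_measure_le hε ?_
    calc P {ω | ε ≤ dist ((Z u).toAEEqFun ω) ((Z v).toAEEqFun ω)}
        ≤ P (U ⁻¹' Set.Ioc u v) := by
          refine measure_mono_ae ?_
          filter_upwards [hZg u, hZg v] with ω hu hv hd
          by_contra hω
          refine (hdist _ _ ?_).not_ge hd
          rw [hu, hv]
          by_cases h1 : U ω ≤ u
          · simp [g, h1, h1.trans huv]
          · have h2 : ¬ U ω ≤ v := fun h2 => hω ⟨not_le.1 h1, h2⟩
            simp [g, h1, h2]
      _ = ENNReal.ofReal (v - u) := by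
          rw [hUmap _ measurableSet_Ioc, unitInterval.volume_Ioc]
      _ ≤ ENNReal.ofReal ε := ENNReal.ofReal_le_ofReal h
  refine ⟨Z, hZ0 0 rfl, hZ1 1 rfl, hZ, fun u => ?_, fun u v huv => ?_⟩
  · refine dist_le_of_measure_le (by positivity) ?_
    calc P {ω | dist X Y + 2 * ε ≤ dist ((Z u).toAEEqFun ω) (X.toAEEqFun ω)}
        -- Where `Z u` carries the label of `X` it is within `ε` of `X`. Elsewhere it is within `ε`
        -- of `Y`, so a large distance to `X` forces a large distance between `X` and `Y`.
        ≤ P {ω | dist X Y + ε ≤ dist (X.toAEEqFun ω) (Y.toAEEqFun ω)} := by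
          refine measure_mono_ae ?_
          filter_upwards [hZg u] with ω hω hd
          change dist X Y + 2 * ε ≤ dist ((Z u).toAEEqFun ω) (X.toAEEqFun ω) at hd
          change dist X Y + ε ≤ dist (X.toAEEqFun ω) (Y.toAEEqFun ω)
          by_cases h : U ω ≤ u
          · have h1 := hdist ((Z u).toAEEqFun ω) (Y.toAEEqFun ω) (by
              simpa [g, h, hy] using hω)
            have h2 := dist_triangle_right ((Z u).toAEEqFun ω) (X.toAEEqFun ω) (Y.toAEEqFun ω)
            linarith
          · have h1 := hdist ((Z u).toAEEqFun ω) (X.toAEEqFun ω) (by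
              simpa [g, h, hx] using hω)
            linarith [dist_nonneg (x := X) (y := Y)]
      _ ≤ ENNReal.ofReal (dist X Y + ε) := measure_le_of_dist_lt (by linarith)
      _ ≤ ENNReal.ofReal (dist X Y + 2 * ε) := ENNReal.ofReal_le_ofReal (by linarith)
  · rcases le_total u v with h | h
    · exact hclose u v h ((le_abs_self _).trans (by rwa [abs_sub_comm]))
    · rw [dist_comm]
      exact hclose v u h ((le_abs_self _).trans huv)

/-- The `Z u` are lifted separately for each `u`, so they need not depend continuously on `u`;
sampling them at spacing `1 / (n + 1)` still gives a fine chain. -/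
theorem chainConnected_law (hP : IsNonatomic P) (ν : ProbabilityMeasure S) :
    ChainConnected {X : RandomVar P S | X.law = ν} := by
  intro X hX Y hY η hη
  obtain ⟨Z, hZ0, hZ1, hZ, hZX, hZd⟩ := exists_mixtures hP hX hY (half_pos hη)
  obtain ⟨n, hn⟩ := exists_nat_one_div_lt (half_pos hη)
  let u : ℕ → I := fun k => Set.projIcc 0 1 zero_le_one ((k : ℝ) / (n + 1))
  have hchain : ∀ k, Relation.ReflTransGen
      (fun V W => (W ∈ {X : RandomVar P S | X.law = ν} ∧ dist W X ≤ dist X Y + η) ∧ dist V W < η)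
      (Z (u 0)) (Z (u k)) := by
    intro k
    induction k with
    | zero => exact .refl
    | succ k ih =>
      refine ih.tail ⟨⟨hZ _, by linarith [hZX (u (k + 1))]⟩, ?_⟩
      refine lt_of_le_of_lt (hZd _ _ ?_) (half_lt_self hη)
      refine (Set.abs_projIcc_sub_projIcc zero_le_one).trans ?_
      rw [← sub_div, abs_div, abs_of_pos (Nat.cast_add_one_pos (α := ℝ) n)]
      push_cast
      rw [sub_add_cancel_left, abs_neg, abs_one]
      exact hn.le
  have h := hchain (n + 1)
  have h0 : u 0 = 0 := by simp [u]
  have h1 : u (n + 1) = 1 := by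
    simp only [u]
    rw [Nat.cast_add_one, div_self (Nat.cast_add_one_ne_zero n)]
    simp
  rwa [h0, h1, hZ0, hZ1] at h

end RandomVar

theorem theorem2 {S : Type*} [MetricSpace S] [CompleteSpace S] [TopologicalSpace.SeparableSpace S]
    [MeasurableSpace S] [BorelSpace S]
    {Ω : Type*} [MeasurableSpace Ω] (P : Measure Ω) [IsProbabilityMeasure P] [P.IsComplete]
    (hP : IsNonatomic P)
    (α : I → ProbabilityMeasure S) (hα : Continuous α) :
    (∃ αhat : I → RandomVar P S, Continuous αhat ∧ ∀ t, (αhat t).law = α t) ∧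
    ∀ Xμ Xν : RandomVar P S, Xμ.law = α 0 → Xν.law = α 1 →
      ∃ αhat : I → RandomVar P S, Continuous αhat ∧ αhat 0 = Xμ ∧ αhat 1 = Xν ∧
        ∀ t, (αhat t).law = α t := by
  have : SecondCountableTopology S := UniformSpace.secondCountable_of_separable S
  have hlift : ∀ Xμ Xν : RandomVar P S, Xμ.law = α 0 → Xν.law = α 1 →
      ∃ αhat : I → RandomVar P S, Continuous αhat ∧ αhat 0 = Xμ ∧ αhat 1 = Xν ∧
        ∀ t, (αhat t).law = α t := fun Xμ Xν hμ hν =>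
    exists_continuous_section RandomVar.dist_le_one
      (fun r => RandomVar.isClosed_setOf_law_eq (α r)) (fun r => RandomVar.exists_law_eq hP (α r))
      (RandomVar.fibersOpen_law hP hα) (fun r => RandomVar.chainConnected_law hP (α r)) hμ hν
  refine ⟨?_, hlift⟩
  obtain ⟨X, hX⟩ := RandomVar.exists_law_eq hP (α 0)
  obtain ⟨Y, hY⟩ := RandomVar.exists_law_eq hP (α 1)
  obtain ⟨αhat, hc, -, -, hlaw⟩ := hlift X Y hX hY
  exact ⟨αhat, hc, hlaw⟩
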